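/- Let $\Theta\in(0,2\pi)$, let $$\Omega=\{(x,y)\in\mathbb R^2:\ 0<x^2+y^2<1,\ \text{the polar angle of }(x,y)\text{ lies in }(0,\Theta)\}$$ be the open circular sector of angle $\Theta$, let $Q=(0,1)\times(0,\Theta)$ and $F(r,\theta)=r(\cos\theta,\sin\theta)$. All functions are real-valued. For a positive weight $w$ on $Q$ let $L^2_w(Q)$ be the space of (a.e. classes of) measurable $v$ on $Q$ with $\|v\|_{L^2_w(Q)}^2=\iint_Q v^2\,w\,dr\,d\theta<\infty$, and let $\tilde H^1(Q)$ be the space of all $u\in L^2_r(Q)$ whose weak derivatives on $Q$ satisfy $\partial_r u\in L^2_r(Q)$ and $\partial_\theta u\in L^2_{1/r}(Q)$, with the norm $$\|u\|_{\tilde H^1(Q)}^2=\iint_Q\Big(r\,u^2+r\,(\partial_r u)^2+\tfrac1r(\partial_\theta u)^2\Big)\,dr\,d\theta .$$ Let $H^1(\Omega)$ be the usual Sobolev space with the norm $\|\hat u\|_{H^1(\Omega)}^2=\int_\Omega(\hat u^2+|\nabla\hat u|^2)$. Then $\Phi:\hat u\mapsto\hat u\circ F$ is a well-defined linear map (on a.e.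 classes) from $L^2(\Omega)$ to $L^2_r(Q)$, and it restricts to a linear isometry from $H^1(\Omega)$ onto $\tilde H^1(Q)$. -/

import Mathlib

open MeasureTheory Set TopologicalSpace
open scoped ENNReal Distributions

namespace PolarSobolev

/-! ### Weak partial derivatives -/

/-- `g` is the weak derivative of `f` in the direction `e` on the open set `U ⊆ ℝ²`: both functions
are locally integrable on `U` and `∫_U f ∂ₑφ = - ∫_U g φ` for all smooth `φ` with compact support
in `U`. -/
def HasWeakPartial (U : Opens (ℝ × ℝ)) (e : ℝ × ℝ) (f g : ℝ × ℝ → ℝ) : Prop :=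
  LocallyIntegrableOn f U ∧ LocallyIntegrableOn g U ∧
    ∀ φ : 𝓓(U, ℝ), ∫ p in U, f p * fderiv ℝ φ p e = -∫ p in U, g p * φ p

section WeakPartial

variable {U : Opens (ℝ × ℝ)} {e : ℝ × ℝ}

theorem integrableOn_mul_of_compact {f ψ : ℝ × ℝ → ℝ} (hf : LocallyIntegrableOn f U)
    (hψ : Continuous ψ) (hc : HasCompactSupport ψ) (hs : tsupport ψ ⊆ U) :
    IntegrableOn (fun p => f p * ψ p) U := by
  have h1 : IntegrableOn (fun p => f p * ψ p) (tsupport ψ) :=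
    (hf.integrableOn_compact_subset hs hc).mul_continuousOn hψ.continuousOn hc
  have h2 : Integrable (fun p => f p * ψ p) := by
    rwa [← integrableOn_iff_integrable_of_support_subset]
    intro p hp
    exact subset_tsupport ψ (fun h => hp (by simp [h]))
  exact h2.integrableOn

theorem integrableOn_mul_test {f : ℝ × ℝ → ℝ} (hf : LocallyIntegrableOn f U) (φ : 𝓓(U, ℝ)) :
    IntegrableOn (fun p => f p * φ p) U :=
  integrableOn_mul_of_compact hf φ.continuous φ.hasCompactSupport φ.tsupport_subset

theorem integrableOn_mul_fderiv {f : ℝ × ℝ → ℝ} (hf : LocallyIntegrableOn f U) (φ : 𝓓(U, ℝ))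
    (e : ℝ × ℝ) : IntegrableOn (fun p => f p * fderiv ℝ φ p e) U :=
  integrableOn_mul_of_compact hf
    ((φ.contDiff.continuous_fderiv (by simp)).clm_apply continuous_const)
    (φ.hasCompactSupport.fderiv_apply ℝ e)
    ((tsupport_fderiv_apply_subset ℝ e).trans φ.tsupport_subset)

theorem HasWeakPartial.congr {f f' g g' : ℝ × ℝ → ℝ} (h : HasWeakPartial U e f g)
    (hf : f =ᵐ[volume.restrict (U : Set (ℝ × ℝ))] f')
    (hg : g =ᵐ[volume.restrict (U : Set (ℝ × ℝ))] g') : HasWeakPartial U e f' g' := by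
  obtain ⟨h1, h2, h3⟩ := h
  have key : ∀ {k k' : ℝ × ℝ → ℝ}, k =ᵐ[volume.restrict (U : Set (ℝ × ℝ))] k' →
      LocallyIntegrableOn k U → LocallyIntegrableOn k' U := by
    intro k k' hk h
    rw [locallyIntegrableOn_iff U.isOpen.isLocallyClosed] at h ⊢
    intro K hKU hK
    exact (h K hKU hK).congr (ae_restrict_of_ae_restrict_of_subset hKU hk)
  refine ⟨key hf h1, key hg h2, fun φ => ?_⟩
  have e1 : ∫ p in U, f' p * fderiv ℝ φ p e = ∫ p in U, f p * fderiv ℝ φ p e :=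
    integral_congr_ae (by filter_upwards [hf] with p hp; rw [hp])
  have e2 : ∫ p in U, g' p * φ p = ∫ p in U, g p * φ p :=
    integral_congr_ae (by filter_upwards [hg] with p hp; rw [hp])
  rw [e1, e2, h3 φ]

theorem HasWeakPartial.add {f f' g g' : ℝ × ℝ → ℝ} (h : HasWeakPartial U e f g)
    (h' : HasWeakPartial U e f' g') : HasWeakPartial U e (f + f') (g + g') := by
  refine ⟨h.1.add h'.1, h.2.1.add h'.2.1, fun φ => ?_⟩
  simp only [Pi.add_apply, add_mul]
  rw [integral_add (integrableOn_mul_fderiv h.1 φ e) (integrableOn_mul_fderiv h'.1 φ e),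
    integral_add (integrableOn_mul_test h.2.1 φ) (integrableOn_mul_test h'.2.1 φ),
    h.2.2 φ, h'.2.2 φ]
  ring

theorem HasWeakPartial.const_smul {f g : ℝ × ℝ → ℝ} (c : ℝ) (h : HasWeakPartial U e f g) :
    HasWeakPartial U e (c • f) (c • g) := by
  refine ⟨h.1.smul c, h.2.1.smul c, fun φ => ?_⟩
  simp only [Pi.smul_apply, smul_eq_mul, mul_assoc]
  rw [integral_const_mul, integral_const_mul, h.2.2 φ]
  ring

theorem hasWeakPartial_zero : HasWeakPartial U e 0 0 := by
  refine ⟨?_, ?_, fun φ => by simp⟩ <;> exact (locallyIntegrable_zero).locallyIntegrableOn _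

theorem HasWeakPartial.unique {f g g' : ℝ × ℝ → ℝ} (h : HasWeakPartial U e f g)
    (h' : HasWeakPartial U e f g') : g =ᵐ[volume.restrict (U : Set (ℝ × ℝ))] g' := by
  have := U.isOpen.ae_eq_zero_of_integral_contDiff_smul_eq_zero (μ := volume)
    (f := g - g') (h.2.1.sub h'.2.1) ?_
  · rw [Filter.EventuallyEq, ae_restrict_iff' U.isOpen.measurableSet]
    filter_upwards [this] with p hp hpU
    exact sub_eq_zero.1 (hp hpU)
  · intro ψ hψ hc hs
    let φ : 𝓓(U, ℝ) := ⟨ψ, hψ, hc, hs⟩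
    have e1 : ∫ p in U, g p * ψ p = ∫ p in U, g' p * ψ p := by
      have := (h.2.2 φ).symm.trans (h'.2.2 φ)
      exact neg_injective this
    have i1 : IntegrableOn (fun p => g p * ψ p) U := integrableOn_mul_test h.2.1 φ
    have i2 : IntegrableOn (fun p => g' p * ψ p) U := integrableOn_mul_test h'.2.1 φ
    have e2 : ∫ p in U, (g p * ψ p - g' p * ψ p) = 0 := by
      rw [integral_sub i1 i2, e1, sub_self]
    rw [setIntegral_eq_integral_of_forall_compl_eq_zero] at e2
    · rw [← e2]
      congr 1
      ext p
      simp only [Pi.sub_apply, smul_eq_mul]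
      ring
    · intro p hp
      have : ψ p = 0 := image_eq_zero_of_notMem_tsupport (fun h => hp (hs h))
      simp [this]

end WeakPartial

/-! ### Weighted Lebesgue and Sobolev spaces -/

/-- `μ` has the same null sets as Lebesgue measure on `U`, so that `μ`-a.e. classes of functions
are the same as Lebesgue-a.e. classes of functions on `U`. -/
class SameNullSets (U : Opens (ℝ × ℝ)) (μ : Measure (ℝ × ℝ)) : Prop where
  ac : μ ≪ volume.restrict (U : Set (ℝ × ℝ))
  ca : volume.restrict (U : Set (ℝ × ℝ)) ≪ μ

instance instSameNullSetsVolume (U : Opens (ℝ × ℝ)) :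
    SameNullSets U (volume.restrict (U : Set (ℝ × ℝ))) :=
  ⟨Measure.AbsolutelyContinuous.rfl, Measure.AbsolutelyContinuous.rfl⟩

/-- The measure `w dx` on `U`. The weighted Lebesgue space `L²_w(U)` is
`Lp ℝ 2 (weightedMeasure U w)`. -/
noncomputable def weightedMeasure (U : Opens (ℝ × ℝ)) (w : ℝ × ℝ → ℝ) : Measure (ℝ × ℝ) :=
  (volume.restrict (U : Set (ℝ × ℝ))).withDensity fun p => ENNReal.ofReal (w p)

theorem sameNullSets_weightedMeasure {U : Opens (ℝ × ℝ)} {w : ℝ × ℝ → ℝ} (hw : Measurable w)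
    (hpos : ∀ p ∈ U, 0 < w p) : SameNullSets U (weightedMeasure U w) where
  ac := withDensity_absolutelyContinuous _ _
  ca := by
    refine withDensity_absolutelyContinuous' hw.ennreal_ofReal.aemeasurable ?_
    filter_upwards [ae_restrict_mem U.isOpen.measurableSet] with p hp
    simpa using hpos p hp

section Weighted

variable (U : Opens (ℝ × ℝ)) (μ₀ μ₁ μ₂ : Measure (ℝ × ℝ))
  [SameNullSets U μ₀] [SameNullSets U μ₁] [SameNullSets U μ₂]

/-- The functions in `L²(μ)` that have a weak derivative in the direction `e` on `U`
belonging to `L²(ν)`. -/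
def weakSubmodule (μ ν : Measure (ℝ × ℝ)) [SameNullSets U μ] [SameNullSets U ν] (e : ℝ × ℝ) :
    Submodule ℝ (Lp ℝ 2 μ) where
  carrier := {u | ∃ g : Lp ℝ 2 ν, HasWeakPartial U e u g}
  add_mem' := by
    rintro u v ⟨g, hg⟩ ⟨k, hk⟩
    exact ⟨g + k, (hg.add hk).congr (SameNullSets.ca.ae_eq (Lp.coeFn_add u v).symm)
      (SameNullSets.ca.ae_eq (Lp.coeFn_add g k).symm)⟩
  zero_mem' := ⟨0, hasWeakPartial_zero.congr (SameNullSets.ca.ae_eq (Lp.coeFn_zero ℝ 2 μ).symm)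
      (SameNullSets.ca.ae_eq (Lp.coeFn_zero ℝ 2 ν).symm)⟩
  smul_mem' := by
    rintro c u ⟨g, hg⟩
    exact ⟨c • g, (hg.const_smul c).congr (SameNullSets.ca.ae_eq (Lp.coeFn_smul c u).symm)
      (SameNullSets.ca.ae_eq (Lp.coeFn_smul c g).symm)⟩

/-- The weak derivative in the direction `e`, as a linear map into `L²(ν)`. -/
noncomputable def weakPartial (μ ν : Measure (ℝ × ℝ)) [SameNullSets U μ] [SameNullSets U ν]
    (e : ℝ × ℝ) : weakSubmodule U μ ν e →ₗ[ℝ] Lp ℝ 2 ν where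
  toFun u := u.2.choose
  map_add' u v := by
    have h := (u.2.choose_spec.add v.2.choose_spec).congr
      (SameNullSets.ca.ae_eq (Lp.coeFn_add u.1 v.1).symm)
      (SameNullSets.ca.ae_eq (Lp.coeFn_add u.2.choose v.2.choose).symm)
    exact Lp.ext (SameNullSets.ac.ae_eq ((u + v).2.choose_spec.unique h))
  map_smul' c u := by
    have h := (u.2.choose_spec.const_smul c).congr
      (SameNullSets.ca.ae_eq (Lp.coeFn_smul c u.1).symm)
      (SameNullSets.ca.ae_eq (Lp.coeFn_smul c u.2.choose).symm)
    exact Lp.ext (SameNullSets.ac.ae_eq ((c • u).2.choose_spec.unique h))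

/-- The space of all `u ∈ L²(μ₀)` whose weak partial derivatives on `U` satisfy `∂₁u ∈ L²(μ₁)` and
`∂₂u ∈ L²(μ₂)`. Its norm is the one defined below, not the one of `L²(μ₀)`. -/
def WSobolev : Type :=
  ↥(weakSubmodule U μ₀ μ₁ (1, 0) ⊓ weakSubmodule U μ₀ μ₂ (0, 1))

noncomputable instance instAddCommGroupWSobolev : AddCommGroup (WSobolev U μ₀ μ₁ μ₂) :=
  inferInstanceAs
    (AddCommGroup ↥(weakSubmodule U μ₀ μ₁ (1, 0) ⊓ weakSubmodule U μ₀ μ₂ (0, 1)))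

noncomputable instance instModuleWSobolev : Module ℝ (WSobolev U μ₀ μ₁ μ₂) :=
  inferInstanceAs
    (Module ℝ ↥(weakSubmodule U μ₀ μ₁ (1, 0) ⊓ weakSubmodule U μ₀ μ₂ (0, 1)))

variable {U μ₀ μ₁ μ₂}

/-- The inclusion into `L²(μ₀)`. -/
noncomputable def WSobolev.toL2 : WSobolev U μ₀ μ₁ μ₂ →ₗ[ℝ] Lp ℝ 2 μ₀ :=
  Submodule.subtype (weakSubmodule U μ₀ μ₁ (1, 0) ⊓ weakSubmodule U μ₀ μ₂ (0, 1))

/-- The weak partial derivative `∂₁u`. -/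
noncomputable def WSobolev.d₁ : WSobolev U μ₀ μ₁ μ₂ →ₗ[ℝ] Lp ℝ 2 μ₁ :=
  weakPartial U μ₀ μ₁ (1, 0) ∘ₗ Submodule.inclusion inf_le_left

/-- The weak partial derivative `∂₂u`. -/
noncomputable def WSobolev.d₂ : WSobolev U μ₀ μ₁ μ₂ →ₗ[ℝ] Lp ℝ 2 μ₂ :=
  weakPartial U μ₀ μ₂ (0, 1) ∘ₗ Submodule.inclusion inf_le_right

/-- The inner product `(u, v)_{L²(μ₀)} + (∂₁u, ∂₁v)_{L²(μ₁)} + (∂₂u, ∂₂v)_{L²(μ₂)}`. -/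
@[reducible]
noncomputable def WSobolev.core : InnerProductSpace.Core ℝ (WSobolev U μ₀ μ₁ μ₂) where
  inner u v := inner ℝ u.toL2 v.toL2 + inner ℝ u.d₁ v.d₁ + inner ℝ u.d₂ v.d₂
  conj_inner_symm u v := by
    simp only [conj_trivial, real_inner_comm]
  re_inner_nonneg u := by
    have h0 := real_inner_self_nonneg (x := u.toL2)
    have h1 := real_inner_self_nonneg (x := u.d₁)
    have h2 := real_inner_self_nonneg (x := u.d₂)
    simp only [RCLike.re_to_real]
    linarith
  add_left u v w := by
    simp only [map_add, inner_add_left]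
    ring
  smul_left u v c := by
    simp only [map_smul, real_inner_smul_left, conj_trivial]
    ring
  definite u h := by
    have h0 := real_inner_self_nonneg (x := u.toL2)
    have h1 := real_inner_self_nonneg (x := u.d₁)
    have h2 := real_inner_self_nonneg (x := u.d₂)
    have h3 : inner ℝ u.toL2 u.toL2 = 0 := by linarith
    exact Subtype.ext (inner_self_eq_zero.1 h3)

noncomputable instance instNormedAddCommGroupWSobolev :
    NormedAddCommGroup (WSobolev U μ₀ μ₁ μ₂) :=
  WSobolev.core.toNormedAddCommGroup

noncomputable instance instInnerProductSpaceWSobolev :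
    InnerProductSpace ℝ (WSobolev U μ₀ μ₁ μ₂) :=
  InnerProductSpace.ofCore WSobolev.core.toCore

end Weighted

/-- The Sobolev space `H¹(U)`. -/
abbrev H1 (U : Opens (ℝ × ℝ)) : Type :=
  WSobolev U (volume.restrict (U : Set (ℝ × ℝ))) (volume.restrict (U : Set (ℝ × ℝ)))
    (volume.restrict (U : Set (ℝ × ℝ)))

/-! ### The sector, the rectangle and the polar map -/

/-- The polar angle of `p ≠ 0`, with values in `(0, 2π]`. -/
noncomputable def polarAngle (p : ℝ × ℝ) : ℝ := Real.pi + Complex.arg (-(⟨p.1, p.2⟩ : ℂ))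

theorem isOpen_sector (Θ : ℝ) : IsOpen {p : ℝ × ℝ |
    0 < p.1 ^ 2 + p.2 ^ 2 ∧ p.1 ^ 2 + p.2 ^ 2 < 1 ∧ 0 < polarAngle p ∧ polarAngle p < Θ} := by
  have hc : Continuous fun p : ℝ × ℝ => p.1 ^ 2 + p.2 ^ 2 := by fun_prop
  have h1 : IsOpen {p : ℝ × ℝ | 0 < p.1 ^ 2 + p.2 ^ 2} := isOpen_lt continuous_const hc
  have h2 : IsOpen {p : ℝ × ℝ | p.1 ^ 2 + p.2 ^ 2 < 1} := isOpen_lt hc continuous_const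
  have hpos : ∀ p : ℝ × ℝ, 0 < polarAngle p := fun p => by
    have := Complex.neg_pi_lt_arg (-(⟨p.1, p.2⟩ : ℂ))
    unfold polarAngle; linarith
  have hle : ∀ p : ℝ × ℝ, polarAngle p ≤ 2 * Real.pi := fun p => by
    have := Complex.arg_le_pi (-(⟨p.1, p.2⟩ : ℂ))
    unfold polarAngle; linarith
  rw [isOpen_iff_mem_nhds]
  rintro p ⟨ha, hb, -, hd⟩
  have h3 : ∀ᶠ q in nhds p, polarAngle q < Θ := by
    rcases lt_or_ge (2 * Real.pi) Θ with h | h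
    · exact Filter.Eventually.of_forall fun q => (hle q).trans_lt h
    · have hs : -(⟨p.1, p.2⟩ : ℂ) ∈ Complex.slitPlane := by
        rw [Complex.mem_slitPlane_iff_arg]
        constructor
        · intro h'
          unfold polarAngle at hd
          rw [h'] at hd
          linarith
        · intro h'
          have e1 := congrArg Complex.re h'
          have e2 := congrArg Complex.im h'
          simp only [Complex.neg_re, Complex.neg_im, Complex.zero_re, Complex.zero_im,
            neg_eq_zero] at e1 e2
          rw [e1, e2] at ha
          norm_num at ha
      have hm : Continuous fun q : ℝ × ℝ => -(⟨q.1, q.2⟩ : ℂ) :=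
        (Complex.equivRealProdCLM.symm.continuous).neg
      have : ContinuousAt polarAngle p :=
        continuousAt_const.add
          (ContinuousAt.comp (f := fun q : ℝ × ℝ => -(⟨q.1, q.2⟩ : ℂ)) (g := Complex.arg)
            (Complex.continuousAt_arg hs) hm.continuousAt)
      exact this.eventually_lt continuousAt_const hd
  filter_upwards [h1.mem_nhds ha, h2.mem_nhds hb, h3] with q q1 q2 q3
  exact ⟨q1, q2, hpos q, q3⟩

/-- The open circular sector `Ω` of radius `1` and angle `Θ`. -/
noncomputable def sector (Θ : ℝ) : Opens (ℝ × ℝ) where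
  carrier := {p | 0 < p.1 ^ 2 + p.2 ^ 2 ∧ p.1 ^ 2 + p.2 ^ 2 < 1 ∧
    0 < polarAngle p ∧ polarAngle p < Θ}
  is_open' := isOpen_sector Θ

/-- The open rectangle `Q = (0, 1) × (0, Θ)`. -/
def rect (Θ : ℝ) : Opens (ℝ × ℝ) where
  carrier := Ioo 0 1 ×ˢ Ioo 0 Θ
  is_open' := isOpen_Ioo.prod isOpen_Ioo

/-- The polar map `F(r, θ) = r (cos θ, sin θ)`. -/
noncomputable def polarMap (p : ℝ × ℝ) : ℝ × ℝ := (p.1 * Real.cos p.2, p.1 * Real.sin p.2)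

/-- The measure `r dr dθ` on `Q`; `L²_r(Q)` is `Lp ℝ 2 (measR Θ)`. -/
noncomputable def measR (Θ : ℝ) : Measure (ℝ × ℝ) := weightedMeasure (rect Θ) fun p => p.1

/-- The measure `r⁻¹ dr dθ` on `Q`; `L²_{1/r}(Q)` is `Lp ℝ 2 (measRInv Θ)`. -/
noncomputable def measRInv (Θ : ℝ) : Measure (ℝ × ℝ) := weightedMeasure (rect Θ) fun p => p.1⁻¹

instance instSameNullSetsMeasR (Θ : ℝ) : SameNullSets (rect Θ) (measR Θ) :=
  sameNullSets_weightedMeasure measurable_fst fun _ hp => hp.1.1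

instance instSameNullSetsMeasRInv (Θ : ℝ) : SameNullSets (rect Θ) (measRInv Θ) :=
  sameNullSets_weightedMeasure measurable_fst.inv fun _ hp => inv_pos.2 hp.1.1

/-- The weighted Sobolev space `H̃¹(Q)`: all `u ∈ L²_r(Q)` with `∂_r u ∈ L²_r(Q)` and
`∂_θ u ∈ L²_{1/r}(Q)`, with squared norm `∫∫ (r u² + r (∂_r u)² + r⁻¹ (∂_θ u)²) dr dθ`. -/
abbrev HTilde (Θ : ℝ) : Type := WSobolev (rect Θ) (measR Θ) (measR Θ) (measRInv Θ)

end PolarSobolev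

/-!
For a constant vector `e` and the closed one-form `ω = (dx₁ ∧ dx₂)(e, ·)`, the derivative of a test
function satisfies `∂ₑχ dx₁ ∧ dx₂ = dχ ∧ ω`. Transported by a diffeomorphism, `ω` becomes another
exact form `dw`. For smooth `w` the one-form `g` of weak derivatives of `f` satisfies
`∫ f dψ ∧ dw = -∫ ψ g ∧ dw`, because `dψ ∧ dw` is the curl of the test field `ψ dw`. This gives the
chain rule for weak derivatives with nothing but local integrability, so it applies to `F` and to
its inverse alike.

The polar map satisfies `∂_θ F = r R (∂_r F)`, where `R` is the rotation by `π / 2` and `r` is also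
the Jacobian determinant. These weighted Cauchy–Riemann equations make the Dirichlet energy
invariant: `r (∂_r u)² + r⁻¹ (∂_θ u)² = r |∇û|²` pointwise. Hence a pullback is in `H̃¹(Q)` if and
only if the original function is in `H¹(Ω)`, with the same norm.
-/

namespace PolarSobolev

open scoped ContDiff

/-! ### The area form and Jacobian determinants in the plane -/

/-- The contraction of the area form `dx₁ ∧ dx₂` with the vector `e`. -/
noncomputable def cross (e : ℝ × ℝ) : ℝ × ℝ →L[ℝ] ℝ :=
  e.1 • ContinuousLinearMap.snd ℝ ℝ ℝ - e.2 • ContinuousLinearMap.fst ℝ ℝ ℝ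

theorem cross_apply (x y : ℝ × ℝ) : cross x y = x.1 * y.2 - x.2 * y.1 := by simp [cross]

theorem det_prod_eq (L : ℝ × ℝ →L[ℝ] ℝ × ℝ) : L.det = cross (L (1, 0)) (L (0, 1)) := by
  rw [ContinuousLinearMap.det, ← LinearMap.det_toMatrix (Module.Basis.finTwoProd ℝ),
    Matrix.det_fin_two, cross_apply]
  simp [LinearMap.toMatrix_apply, mul_comm]

theorem clm_prod_apply {E : Type*} [NormedAddCommGroup E] [NormedSpace ℝ E]
    (L : ℝ × ℝ →L[ℝ] E) (v : ℝ × ℝ) : L v = v.1 • L (1, 0) + v.2 • L (0, 1) := by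
  rw [← map_smul, ← map_smul, ← map_add]
  simp

theorem cross_map (L : ℝ × ℝ →L[ℝ] ℝ × ℝ) (x y : ℝ × ℝ) :
    cross (L x) (L y) = L.det * cross x y := by
  rw [det_prod_eq, clm_prod_apply L x, clm_prod_apply L y]
  simp only [cross_apply, Prod.fst_add, Prod.snd_add, Prod.smul_fst, Prod.smul_snd, smul_eq_mul]
  ring

/-- The Jacobian determinant of the pair `(ψ, w)`, that is, the coefficient of `dψ ∧ dw`. -/
noncomputable def jacobian (ψ w : ℝ × ℝ → ℝ) (p : ℝ × ℝ) : ℝ :=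
  fderiv ℝ ψ p (1, 0) * fderiv ℝ w p (0, 1) - fderiv ℝ ψ p (0, 1) * fderiv ℝ w p (1, 0)

theorem jacobian_comp {ψ w : ℝ × ℝ → ℝ} {G : ℝ × ℝ → ℝ × ℝ} {p : ℝ × ℝ}
    (hψ : DifferentiableAt ℝ ψ (G p)) (hw : DifferentiableAt ℝ w (G p))
    (hG : DifferentiableAt ℝ G p) :
    jacobian (ψ ∘ G) (w ∘ G) p = (fderiv ℝ G p).det * jacobian ψ w (G p) := by
  simp only [jacobian, fderiv_comp p hψ hG, fderiv_comp p hw hG, ContinuousLinearMap.comp_apply,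
    det_prod_eq, cross_apply, clm_prod_apply (fderiv ℝ ψ (G p)) (fderiv ℝ G p _),
    clm_prod_apply (fderiv ℝ w (G p)) (fderiv ℝ G p _), smul_eq_mul]
  ring

theorem jacobian_cross (ψ : ℝ × ℝ → ℝ) (e q : ℝ × ℝ) :
    jacobian ψ (cross e) q = fderiv ℝ ψ q e := by
  rw [clm_prod_apply (fderiv ℝ ψ q) e, jacobian, (cross e).fderiv]
  simp [cross_apply, mul_comm]

/-! ### Test functions and the weak Jacobian identity -/

theorem exists_testFunction_eqOn {U : Opens (ℝ × ℝ)} {K : Set (ℝ × ℝ)} {a : ℝ × ℝ → ℝ}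
    (ha : ContDiffOn ℝ ∞ a U) (hK : IsCompact K) (hKU : K ⊆ U)
    (h0 : ∀ p ∈ U, p ∉ K → a p = 0) : ∃ ψ : 𝓓(U, ℝ), EqOn ψ a U := by
  classical
  have hts : tsupport ((U : Set (ℝ × ℝ)).indicator a) ⊆ K := by
    refine closure_minimal (fun p hp => ?_) hK.isClosed
    by_contra hpK
    exact hp (indicator_apply_eq_zero.2 fun hpU => h0 p hpU hpK)
  refine ⟨⟨(U : Set (ℝ × ℝ)).indicator a, ?_, hK.of_isClosed_subset (isClosed_tsupport _) hts,
    hts.trans hKU⟩, fun p hp => indicator_of_mem hp a⟩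
  rw [contDiff_iff_contDiffAt]
  intro p
  by_cases hpU : p ∈ (U : Set (ℝ × ℝ))
  · exact (ha.contDiffAt (U.isOpen.mem_nhds hpU)).congr_of_eventuallyEq
      ((eqOn_indicator (f := a)).eventuallyEq_of_mem (U.isOpen.mem_nhds hpU))
  · exact contDiffAt_const.congr_of_eventuallyEq
      (notMem_tsupport_iff_eventuallyEq.1 fun h => hpU (hKU (hts h)))

section WeakJacobian

variable {U : Opens (ℝ × ℝ)}

theorem exists_testFunction_eqOn_mul {a : ℝ × ℝ → ℝ} (ha : ContDiffOn ℝ ∞ a U) (ψ : 𝓓(U, ℝ)) :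
    ∃ η : 𝓓(U, ℝ), EqOn η (fun p => ψ p * a p) U :=
  exists_testFunction_eqOn (ψ.contDiff.contDiffOn.mul ha) ψ.hasCompactSupport ψ.tsupport_subset
    fun p _ hp => by rw [image_eq_zero_of_notMem_tsupport hp, zero_mul]

theorem contDiffOn_fderiv_apply {w : ℝ × ℝ → ℝ} (hw : ContDiffOn ℝ ∞ w U) (v : ℝ × ℝ) :
    ContDiffOn ℝ ∞ (fun p => fderiv ℝ w p v) U :=
  (hw.fderiv_of_isOpen U.isOpen (by simp)).clm_apply contDiffOn_const

/-- Since `d(ψ dw) = dψ ∧ dw`, the Jacobian is the curl of a compactly supported field. -/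
theorem jacobian_eq_of_eqOn_mul_fderiv {w : ℝ × ℝ → ℝ} (hw : ContDiffOn ℝ ∞ w U)
    {ψ η₁ η₂ : 𝓓(U, ℝ)} (h₁ : EqOn η₁ (fun p => ψ p * fderiv ℝ w p (1, 0)) U)
    (h₂ : EqOn η₂ (fun p => ψ p * fderiv ℝ w p (0, 1)) U) {p : ℝ × ℝ} (hp : p ∈ U) :
    jacobian ψ w p = fderiv ℝ η₂ p (1, 0) - fderiv ℝ η₁ p (0, 1) := by
  have hn := U.isOpen.mem_nhds hp
  have hwp : ContDiffAt ℝ ∞ w p := hw.contDiffAt hn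
  have hψ : DifferentiableAt ℝ ψ p := ψ.contDiff.differentiable (by simp) p
  have hdw : DifferentiableAt ℝ (fderiv ℝ w) p :=
    (hwp.fderiv_right (m := ∞) (by simp)).differentiableAt (by simp)
  have hprod : ∀ v : ℝ × ℝ, fderiv ℝ (fun x => ψ x * fderiv ℝ w x v) p =
      ψ p • (fderiv ℝ (fderiv ℝ w) p).flip v + fderiv ℝ w p v • fderiv ℝ ψ p := fun v => by
    have hv : DifferentiableAt ℝ (fun x => fderiv ℝ w x v) p :=
      hdw.clm_apply (differentiableAt_const v)
    rw [fderiv_fun_mul hψ hv, fderiv_clm_apply hdw (differentiableAt_const v)]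
    simp
  have hsymm : fderiv ℝ (fderiv ℝ w) p (1, 0) (0, 1) = fderiv ℝ (fderiv ℝ w) p (0, 1) (1, 0) :=
    hwp.isSymmSndFDerivAt (by simpa using ENat.LEInfty.out) _ _
  rw [(h₁.eventuallyEq_of_mem hn).fderiv_eq, (h₂.eventuallyEq_of_mem hn).fderiv_eq, hprod, hprod,
    jacobian]
  simp only [add_apply, smul_apply, ContinuousLinearMap.flip_apply, smul_eq_mul, hsymm]
  ring

theorem HasWeakPartial.integral_mul_jacobian {f g₁ g₂ w : ℝ × ℝ → ℝ}
    (h₁ : HasWeakPartial U (1, 0) f g₁) (h₂ : HasWeakPartial U (0, 1) f g₂)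
    (hw : ContDiffOn ℝ ∞ w U) (ψ : 𝓓(U, ℝ)) :
    ∫ p in U, f p * jacobian ψ w p =
      -∫ p in U, (g₁ p * fderiv ℝ w p (0, 1) - g₂ p * fderiv ℝ w p (1, 0)) * ψ p := by
  obtain ⟨η₁, hη₁⟩ := exists_testFunction_eqOn_mul (contDiffOn_fderiv_apply hw (1, 0)) ψ
  obtain ⟨η₂, hη₂⟩ := exists_testFunction_eqOn_mul (contDiffOn_fderiv_apply hw (0, 1)) ψ
  calc ∫ p in U, f p * jacobian ψ w p
      = ∫ p in U, (f p * fderiv ℝ η₂ p (1, 0) - f p * fderiv ℝ η₁ p (0, 1)) :=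
        setIntegral_congr_fun U.isOpen.measurableSet fun p hp => by
          rw [jacobian_eq_of_eqOn_mul_fderiv hw hη₁ hη₂ hp, mul_sub]
    _ = -∫ p in U, (g₁ p * η₂ p - g₂ p * η₁ p) := by
        rw [integral_sub (integrableOn_mul_fderiv h₁.1 η₂ _) (integrableOn_mul_fderiv h₂.1 η₁ _),
          integral_sub (integrableOn_mul_test h₁.2.1 η₂) (integrableOn_mul_test h₂.2.1 η₁),
          h₁.2.2 η₂, h₂.2.2 η₁]
        ring
    _ = -∫ p in U, (g₁ p * fderiv ℝ w p (0, 1) - g₂ p * fderiv ℝ w p (1, 0)) * ψ p := by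
        refine congrArg _ (setIntegral_congr_fun U.isOpen.measurableSet fun p hp => ?_)
        simp only [hη₁ hp, hη₂ hp]
        ring

end WeakJacobian

/-! ### Orientation preserving diffeomorphisms -/

/-- An orientation preserving diffeomorphism from `V` onto `U`, given by total maps of the plane
whose values outside `V` and `U` are irrelevant. -/
structure OrientedDiffeo (V U : Opens (ℝ × ℝ)) where
  toFun : ℝ × ℝ → ℝ × ℝ
  invFun : ℝ × ℝ → ℝ × ℝ
  mapsTo : MapsTo toFun V U
  mapsTo_inv : MapsTo invFun U V
  leftInvOn : LeftInvOn invFun toFun V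
  rightInvOn : RightInvOn invFun toFun U
  contDiffOn : ContDiffOn ℝ ∞ toFun V
  contDiffOn_inv : ContDiffOn ℝ ∞ invFun U
  det_pos : ∀ q ∈ V, 0 < (fderiv ℝ toFun q).det

namespace OrientedDiffeo

variable {U V : Opens (ℝ × ℝ)}

instance : CoeFun (OrientedDiffeo V U) fun _ => ℝ × ℝ → ℝ × ℝ := ⟨toFun⟩

section

variable (φ : OrientedDiffeo V U)

theorem differentiableAt {q : ℝ × ℝ} (hq : q ∈ V) : DifferentiableAt ℝ φ q :=
  (φ.contDiffOn.contDiffAt (V.isOpen.mem_nhds hq)).differentiableAt (by simp)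

theorem differentiableAt_inv {p : ℝ × ℝ} (hp : p ∈ U) : DifferentiableAt ℝ φ.invFun p :=
  (φ.contDiffOn_inv.contDiffAt (U.isOpen.mem_nhds hp)).differentiableAt (by simp)

theorem fderiv_comp_fderiv_inv {p : ℝ × ℝ} (hp : p ∈ U) :
    (fderiv ℝ φ (φ.invFun p)).comp (fderiv ℝ φ.invFun p) = .id ℝ (ℝ × ℝ) := by
  rw [← fderiv_comp p (φ.differentiableAt (φ.mapsTo_inv hp)) (φ.differentiableAt_inv hp),
    (φ.rightInvOn.eqOn.eventuallyEq_of_mem (U.isOpen.mem_nhds hp)).fderiv_eq, fderiv_id]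

theorem det_fderiv_inv_pos {p : ℝ × ℝ} (hp : p ∈ U) : 0 < (fderiv ℝ φ.invFun p).det := by
  have hmul : (fderiv ℝ φ (φ.invFun p)).det * (fderiv ℝ φ.invFun p).det = 1 := by
    rw [ContinuousLinearMap.det, ContinuousLinearMap.det, ← LinearMap.det_comp,
      ← ContinuousLinearMap.toLinearMap_comp, φ.fderiv_comp_fderiv_inv hp,
      ContinuousLinearMap.coe_id, LinearMap.det_id]
  exact pos_of_mul_pos_right (hmul ▸ one_pos) (φ.det_pos _ (φ.mapsTo_inv hp)).le

/-- The inverse diffeomorphism. -/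
def symm : OrientedDiffeo U V where
  toFun := φ.invFun
  invFun := φ
  mapsTo := φ.mapsTo_inv
  mapsTo_inv := φ.mapsTo
  leftInvOn := φ.rightInvOn
  rightInvOn := φ.leftInvOn
  contDiffOn := φ.contDiffOn_inv
  contDiffOn_inv := φ.contDiffOn
  det_pos _ hp := φ.det_fderiv_inv_pos hp

theorem symm_mem {p : ℝ × ℝ} (hp : p ∈ U) : φ.symm p ∈ V := φ.mapsTo_inv hp

theorem apply_symm {p : ℝ × ℝ} (hp : p ∈ U) : φ (φ.symm p) = p := φ.rightInvOn hp

theorem fderiv_fderiv_symm {p : ℝ × ℝ} (hp : p ∈ U) (v : ℝ × ℝ) :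
    fderiv ℝ φ (φ.symm p) (fderiv ℝ φ.symm p v) = v :=
  DFunLike.congr_fun (φ.fderiv_comp_fderiv_inv hp) v

theorem fderiv_symm_fderiv {p : ℝ × ℝ} (hp : p ∈ U) (v : ℝ × ℝ) :
    fderiv ℝ φ.symm p (fderiv ℝ φ (φ.symm p) v) = v := by
  have h := φ.symm.fderiv_fderiv_symm (φ.symm_mem hp) v
  rwa [show φ.symm.symm = φ from rfl, φ.apply_symm hp] at h

theorem continuousOn_fderiv : ContinuousOn (fderiv ℝ φ) V :=
  φ.contDiffOn.continuousOn_fderiv_of_isOpen V.isOpen (by simp)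

theorem continuousOn_fderiv_apply (e : ℝ × ℝ) : ContinuousOn (fun q => fderiv ℝ φ q e) V :=
  φ.continuousOn_fderiv.clm_apply continuousOn_const

theorem continuousOn_det_fderiv : ContinuousOn (fun q => (fderiv ℝ φ q).det) V :=
  ContinuousLinearMap.continuous_det.comp_continuousOn φ.continuousOn_fderiv

theorem image_eq : φ '' V = U :=
  φ.mapsTo.image_subset.antisymm fun p hp => ⟨φ.symm p, φ.symm_mem hp, φ.apply_symm hp⟩

theorem hasFDerivWithinAt {q : ℝ × ℝ} (hq : q ∈ V) (s : Set (ℝ × ℝ)) :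
    HasFDerivWithinAt φ (fderiv ℝ φ q) s q :=
  (φ.differentiableAt hq).hasFDerivAt.hasFDerivWithinAt

/-! ### Change of variables -/

theorem setIntegral_eq (h : ℝ × ℝ → ℝ) :
    ∫ p in U, h p = ∫ q in V, (fderiv ℝ φ q).det * h (φ q) := by
  rw [← φ.image_eq, integral_image_eq_integral_abs_det_fderiv_smul volume
    V.isOpen.measurableSet (fun q hq => φ.hasFDerivWithinAt hq V) φ.leftInvOn.injOn]
  exact setIntegral_congr_fun V.isOpen.measurableSet fun q hq => by
    simp only [abs_of_pos (φ.det_pos q hq), smul_eq_mul]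

theorem setLIntegral_eq (h : ℝ × ℝ → ℝ≥0∞) :
    ∫⁻ p in U, h p = ∫⁻ q in V, ENNReal.ofReal (fderiv ℝ φ q).det * h (φ q) := by
  rw [← φ.image_eq, lintegral_image_eq_lintegral_abs_det_fderiv_mul volume
    V.isOpen.measurableSet (fun q hq => φ.hasFDerivWithinAt hq V) φ.leftInvOn.injOn]
  exact setLIntegral_congr_fun V.isOpen.measurableSet fun q hq => by
    simp only [abs_of_pos (φ.det_pos q hq)]

theorem measurePreserving (hφ : Measurable φ) {J : ℝ × ℝ → ℝ}
    (hJ : ∀ q ∈ V, (fderiv ℝ φ q).det = J q) :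
    MeasurePreserving φ (weightedMeasure V J) (volume.restrict (U : Set (ℝ × ℝ))) where
  measurable := hφ
  map_eq := by
    have hden : weightedMeasure V J =
        (volume.restrict (V : Set (ℝ × ℝ))).withDensity
          fun q => ENNReal.ofReal |(fderiv ℝ φ q).det| :=
      withDensity_congr_ae <| by
        filter_upwards [ae_restrict_mem V.isOpen.measurableSet] with q hq
        rw [abs_of_pos (φ.det_pos q hq), hJ q hq]
    rw [hden, map_withDensity_abs_det_fderiv_eq_addHaar volume
      V.isOpen.measurableSet.nullMeasurableSet (fun q hq => φ.hasFDerivWithinAt hq V)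
      φ.leftInvOn.injOn, φ.image_eq]

theorem locallyIntegrableOn_comp {f : ℝ × ℝ → ℝ} (hf : LocallyIntegrableOn f U) :
    LocallyIntegrableOn (f ∘ φ) V := by
  rw [locallyIntegrableOn_iff V.isOpen.isLocallyClosed]
  intro K hKV hK
  have hK' : IsCompact (φ '' K) := hK.image_of_continuousOn (φ.contDiffOn.continuousOn.mono hKV)
  have hK'U : φ '' K ⊆ U := (φ.mapsTo.mono_left hKV).image_subset
  have hpre : φ.symm '' (φ '' K) = K := (φ.leftInvOn.mono hKV).image_image
  rw [← hpre, integrableOn_image_iff_integrableOn_abs_det_fderiv_smul volume hK'.measurableSet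
    (fun p hp => φ.symm.hasFDerivWithinAt (hK'U hp) _) (φ.rightInvOn.injOn.mono hK'U)]
  refine ((hf.integrableOn_compact_subset hK'U hK').continuousOn_mul
    (φ.symm.continuousOn_det_fderiv.abs.mono hK'U) hK').congr_fun
    (fun p hp => ?_) hK'.measurableSet
  simp [φ.apply_symm (hK'U hp)]

/-! ### The chain rule for weak derivatives -/

/-- The `e`-component of the pullback along `φ` of the one-form `g₁ dx₁ + g₂ dx₂`. -/
noncomputable def pullbackForm (g₁ g₂ : ℝ × ℝ → ℝ) (e q : ℝ × ℝ) : ℝ :=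
  (fderiv ℝ φ q e).1 * g₁ (φ q) + (fderiv ℝ φ q e).2 * g₂ (φ q)

theorem locallyIntegrableOn_pullbackForm {g₁ g₂ : ℝ × ℝ → ℝ} (h₁ : LocallyIntegrableOn g₁ U)
    (h₂ : LocallyIntegrableOn g₂ U) (e : ℝ × ℝ) :
    LocallyIntegrableOn (φ.pullbackForm g₁ g₂ e) V :=
  ((φ.locallyIntegrableOn_comp h₁).continuousOn_mul (φ.continuousOn_fderiv_apply e).fst
      V.isOpen.isLocallyClosed).add
    ((φ.locallyIntegrableOn_comp h₂).continuousOn_mul (φ.continuousOn_fderiv_apply e).snd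
      V.isOpen.isLocallyClosed)

theorem pullbackForm_symm_pullbackForm (g₁ g₂ : ℝ × ℝ → ℝ) (e : ℝ × ℝ) {p : ℝ × ℝ} (hp : p ∈ U) :
    φ.symm.pullbackForm (φ.pullbackForm g₁ g₂ (1, 0)) (φ.pullbackForm g₁ g₂ (0, 1)) e p =
      e.1 * g₁ p + e.2 * g₂ p := by
  have h := φ.fderiv_fderiv_symm hp e
  rw [clm_prod_apply] at h
  simp only [pullbackForm, φ.apply_symm hp]
  simp only [Prod.ext_iff, Prod.fst_add, Prod.snd_add, Prod.smul_fst, Prod.smul_snd,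
    smul_eq_mul] at h
  linear_combination g₁ p * h.1 + g₂ p * h.2

theorem det_mul_pullbackForm (g₁ g₂ : ℝ × ℝ → ℝ) (e : ℝ × ℝ) {p : ℝ × ℝ} (hp : p ∈ U) :
    (fderiv ℝ φ.symm p).det * φ.pullbackForm g₁ g₂ e (φ.symm p) =
      g₁ p * fderiv ℝ (cross e ∘ φ.symm) p (0, 1) -
        g₂ p * fderiv ℝ (cross e ∘ φ.symm) p (1, 0) := by
  have hω : ∀ x, fderiv ℝ (cross e ∘ φ.symm) p x =
      (fderiv ℝ φ.symm p).det * cross (fderiv ℝ φ (φ.symm p) e) x := fun x => by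
    rw [fderiv_comp p (cross e).differentiableAt (φ.symm.differentiableAt hp), (cross e).fderiv,
      ContinuousLinearMap.comp_apply, ← cross_map, φ.fderiv_symm_fderiv hp]
  simp only [hω, pullbackForm, φ.apply_symm hp, cross_apply]
  ring

theorem exists_testFunction_eqOn_comp (χ : 𝓓(U, ℝ)) : ∃ ψ : 𝓓(V, ℝ), EqOn ψ (χ ∘ φ) V := by
  have hχ : tsupport χ ⊆ U := χ.tsupport_subset
  refine exists_testFunction_eqOn (χ.contDiff.comp_contDiffOn φ.contDiffOn)
    (χ.hasCompactSupport.image_of_continuousOn (φ.symm.contDiffOn.continuousOn.mono hχ))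
    (φ.symm.mapsTo.mono_left hχ).image_subset fun q hq hqK => ?_
  by_contra h
  exact hqK ⟨φ q, subset_tsupport χ h, φ.leftInvOn hq⟩

end

theorem jacobian_comp_cross_comp (φ : OrientedDiffeo V U) {χ : 𝓓(U, ℝ)} {ψ : 𝓓(V, ℝ)}
    (hψ : EqOn ψ (χ ∘ φ) V) (e : ℝ × ℝ) {q : ℝ × ℝ} (hq : q ∈ V) :
    jacobian ψ (cross e ∘ φ) q = (fderiv ℝ φ q).det * fderiv ℝ χ (φ q) e := by
  rw [← jacobian_cross, ← jacobian_comp (χ.contDiff.differentiable (by simp) _)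
    (cross e).differentiableAt (φ.differentiableAt hq), jacobian, jacobian,
    (hψ.eventuallyEq_of_mem (V.isOpen.mem_nhds hq)).fderiv_eq]

end OrientedDiffeo

theorem HasWeakPartial.comp {U V : Opens (ℝ × ℝ)} (φ : OrientedDiffeo V U)
    {f g₁ g₂ : ℝ × ℝ → ℝ} (h₁ : HasWeakPartial U (1, 0) f g₁) (h₂ : HasWeakPartial U (0, 1) f g₂)
    (e : ℝ × ℝ) : HasWeakPartial V e (f ∘ φ) (φ.pullbackForm g₁ g₂ e) := by
  refine ⟨φ.locallyIntegrableOn_comp h₁.1, φ.locallyIntegrableOn_pullbackForm h₁.2.1 h₂.2.1 e,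
    fun χ => ?_⟩
  obtain ⟨ψ, hψ⟩ := φ.symm.exists_testFunction_eqOn_comp χ
  calc ∫ q in V, (f ∘ φ) q * fderiv ℝ χ q e
      = ∫ p in U, f p * jacobian ψ (cross e ∘ φ.symm) p := by
        rw [φ.symm.setIntegral_eq]
        refine setIntegral_congr_fun U.isOpen.measurableSet fun p hp => ?_
        simp only [Function.comp_apply, φ.symm.jacobian_comp_cross_comp hψ e hp, φ.apply_symm hp]
        ring
    _ = -∫ p in U, (g₁ p * fderiv ℝ (cross e ∘ φ.symm) p (0, 1) -
          g₂ p * fderiv ℝ (cross e ∘ φ.symm) p (1, 0)) * ψ p :=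
        h₁.integral_mul_jacobian h₂ ((cross e).contDiff.comp_contDiffOn φ.symm.contDiffOn) ψ
    _ = -∫ q in V, φ.pullbackForm g₁ g₂ e q * χ q := by
        rw [φ.symm.setIntegral_eq]
        refine congrArg _ (setIntegral_congr_fun U.isOpen.measurableSet fun p hp => ?_)
        simp only [← φ.det_mul_pullbackForm g₁ g₂ e hp, hψ hp, Function.comp_apply]
        ring

/-! ### Weighted Cauchy–Riemann equations and the Dirichlet energy -/

theorem eLpNorm_two_sq {α : Type*} [MeasurableSpace α] (μ : Measure α) (f : α → ℝ) :
    eLpNorm f 2 μ ^ 2 = ∫⁻ x, ENNReal.ofReal (f x ^ 2) ∂μ := by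
  have h := eLpNorm_nnreal_pow_eq_lintegral (f := f) (μ := μ) (p := 2) two_ne_zero
  simp only [NNReal.coe_ofNat, ENNReal.rpow_ofNat, ENNReal.coe_ofNat] at h
  simp only [h, ← enorm_pow, Real.enorm_of_nonneg (sq_nonneg _)]

theorem eLpNorm_two_weightedMeasure_sq {U : Opens (ℝ × ℝ)} {w : ℝ × ℝ → ℝ}
    (hw : ContinuousOn w U) (f : ℝ × ℝ → ℝ) :
    eLpNorm f 2 (weightedMeasure U w) ^ 2 = ∫⁻ p in U, ENNReal.ofReal (w p * f p ^ 2) := by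
  have hw' : AEMeasurable w (volume.restrict (U : Set (ℝ × ℝ))) :=
    hw.aemeasurable U.isOpen.measurableSet
  rw [eLpNorm_two_sq, weightedMeasure, lintegral_withDensity_eq_lintegral_mul_non_measurable₀ _
    hw'.ennreal_ofReal (.of_forall fun _ => ENNReal.ofReal_lt_top)]
  simp only [Pi.mul_apply, ← ENNReal.ofReal_mul' (sq_nonneg _)]

/-- The Cauchy–Riemann equations with weight `k`: the second partial derivative of `φ` is `k` times
the first one rotated by `π / 2`. For `k = 1` this says that `φ` is holomorphic. -/
def SatisfiesCauchyRiemann (V : Opens (ℝ × ℝ)) (φ : ℝ × ℝ → ℝ × ℝ) (k : ℝ × ℝ → ℝ) : Prop :=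
  ∀ q ∈ V, fderiv ℝ φ q (0, 1) = k q • (-(fderiv ℝ φ q (1, 0)).2, (fderiv ℝ φ q (1, 0)).1)

namespace SatisfiesCauchyRiemann

variable {U V : Opens (ℝ × ℝ)} {φ : OrientedDiffeo V U} {k : ℝ × ℝ → ℝ}

theorem det_eq {ψ : ℝ × ℝ → ℝ × ℝ} (hk : SatisfiesCauchyRiemann V ψ k) {q : ℝ × ℝ} (hq : q ∈ V) :
    (fderiv ℝ ψ q).det =
      k q * ((fderiv ℝ ψ q (1, 0)).1 ^ 2 + (fderiv ℝ ψ q (1, 0)).2 ^ 2) := by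
  rw [det_prod_eq, cross_apply, hk q hq, Prod.smul_mk, smul_eq_mul, smul_eq_mul]
  ring

theorem pos (hk : SatisfiesCauchyRiemann V φ k) {q : ℝ × ℝ} (hq : q ∈ V) : 0 < k q :=
  pos_of_mul_pos_left (hk.det_eq hq ▸ φ.det_pos q hq) (by positivity)

theorem continuousOn (hk : SatisfiesCauchyRiemann V φ k) : ContinuousOn k V := by
  have hsq : ContinuousOn
      (fun q => (fderiv ℝ φ q (1, 0)).1 ^ 2 + (fderiv ℝ φ q (1, 0)).2 ^ 2) V :=
    ((φ.continuousOn_fderiv_apply _).fst.pow 2).add ((φ.continuousOn_fderiv_apply _).snd.pow 2)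
  have hsq_ne : ∀ q ∈ V, (fderiv ℝ φ q (1, 0)).1 ^ 2 + (fderiv ℝ φ q (1, 0)).2 ^ 2 ≠ 0 :=
    fun q hq => right_ne_zero_of_mul (hk.det_eq hq ▸ (φ.det_pos q hq).ne')
  exact (φ.continuousOn_det_fderiv.div hsq hsq_ne).congr fun q hq =>
    eq_div_of_mul_eq (hsq_ne q hq) (hk.det_eq hq).symm

theorem energyDensity_eq (hk : SatisfiesCauchyRiemann V φ k) (g₁ g₂ : ℝ × ℝ → ℝ)
    {q : ℝ × ℝ} (hq : q ∈ V) :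
    k q * φ.pullbackForm g₁ g₂ (1, 0) q ^ 2 + (k q)⁻¹ * φ.pullbackForm g₁ g₂ (0, 1) q ^ 2 =
      (fderiv ℝ φ q).det * (g₁ (φ q) ^ 2 + g₂ (φ q) ^ 2) := by
  have hk0 := (hk.pos hq).ne'
  simp only [OrientedDiffeo.pullbackForm, hk.det_eq hq, hk q hq, Prod.smul_mk, smul_eq_mul]
  field_simp
  ring

variable {g₁ g₂ : ℝ × ℝ → ℝ}

theorem eLpNorm_pullbackForm_sq_add_sq (hk : SatisfiesCauchyRiemann V φ k)
    (h₁ : LocallyIntegrableOn g₁ U) (h₂ : LocallyIntegrableOn g₂ U) :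
    eLpNorm (φ.pullbackForm g₁ g₂ (1, 0)) 2 (weightedMeasure V k) ^ 2 +
        eLpNorm (φ.pullbackForm g₁ g₂ (0, 1)) 2 (weightedMeasure V fun q => (k q)⁻¹) ^ 2 =
      eLpNorm g₁ 2 (volume.restrict (U : Set (ℝ × ℝ))) ^ 2 +
        eLpNorm g₂ 2 (volume.restrict (U : Set (ℝ × ℝ))) ^ 2 := by
  have hkinv : ContinuousOn (fun q => (k q)⁻¹) V :=
    hk.continuousOn.inv₀ fun q hq => (hk.pos hq).ne'
  have hm₁ : AEMeasurable g₁ (volume.restrict (U : Set (ℝ × ℝ))) :=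
    h₁.aestronglyMeasurable.aemeasurable
  have hmV : AEMeasurable (fun q => k q * φ.pullbackForm g₁ g₂ (1, 0) q ^ 2)
      (volume.restrict (V : Set (ℝ × ℝ))) :=
    (hk.continuousOn.aemeasurable V.isOpen.measurableSet).mul
      ((φ.locallyIntegrableOn_pullbackForm h₁ h₂ _).aestronglyMeasurable.aemeasurable.pow_const 2)
  rw [eLpNorm_two_weightedMeasure_sq hk.continuousOn, eLpNorm_two_weightedMeasure_sq hkinv,
    eLpNorm_two_sq, eLpNorm_two_sq, ← lintegral_add_left' hmV.ennreal_ofReal,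
    ← lintegral_add_left' (hm₁.pow_const 2).ennreal_ofReal, φ.setLIntegral_eq]
  refine setLIntegral_congr_fun V.isOpen.measurableSet fun q hq => ?_
  have hkq := (hk.pos hq).le
  rw [← ENNReal.ofReal_add (by positivity) (by positivity), hk.energyDensity_eq g₁ g₂ hq,
    ENNReal.ofReal_mul (φ.det_pos q hq).le, ENNReal.ofReal_add (sq_nonneg _) (sq_nonneg _)]

theorem memLp_pullbackForm_iff (hk : SatisfiesCauchyRiemann V φ k)
    (h₁ : LocallyIntegrableOn g₁ U) (h₂ : LocallyIntegrableOn g₂ U) :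
    MemLp (φ.pullbackForm g₁ g₂ (1, 0)) 2 (weightedMeasure V k) ∧
        MemLp (φ.pullbackForm g₁ g₂ (0, 1)) 2 (weightedMeasure V fun q => (k q)⁻¹) ↔
      MemLp g₁ 2 (volume.restrict (U : Set (ℝ × ℝ))) ∧
        MemLp g₂ 2 (volume.restrict (U : Set (ℝ × ℝ))) := by
  have hmeas : ∀ (e : ℝ × ℝ) (w : ℝ × ℝ → ℝ),
      AEStronglyMeasurable (φ.pullbackForm g₁ g₂ e) (weightedMeasure V w) := fun e _ =>
    (φ.locallyIntegrableOn_pullbackForm h₁ h₂ e).aestronglyMeasurable.mono_ac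
      (withDensity_absolutelyContinuous _ _)
  have hfin : ∀ a b : ℝ≥0∞, a < ⊤ ∧ b < ⊤ ↔ a ^ 2 + b ^ 2 < ⊤ := fun a b => by
    simp [ENNReal.add_lt_top, ENNReal.pow_lt_top_iff]
  simp only [MemLp, hmeas, h₁.aestronglyMeasurable, h₂.aestronglyMeasurable, true_and, hfin,
    hk.eLpNorm_pullbackForm_sq_add_sq h₁ h₂]

end SatisfiesCauchyRiemann

/-! ### Pullback of Sobolev spaces -/

section WSobolev

variable {U : Opens (ℝ × ℝ)} {μ₀ μ₁ μ₂ : Measure (ℝ × ℝ)}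
  [SameNullSets U μ₀] [SameNullSets U μ₁] [SameNullSets U μ₂]

theorem WSobolev.toL2_injective :
    Function.Injective (WSobolev.toL2 : WSobolev U μ₀ μ₁ μ₂ →ₗ[ℝ] Lp ℝ 2 μ₀) :=
  Subtype.val_injective

theorem WSobolev.hasWeakPartial_d₁ (u : WSobolev U μ₀ μ₁ μ₂) :
    HasWeakPartial U (1, 0) u.toL2 u.d₁ :=
  (Submodule.inclusion inf_le_left u : weakSubmodule U μ₀ μ₁ (1, 0)).2.choose_spec

theorem WSobolev.hasWeakPartial_d₂ (u : WSobolev U μ₀ μ₁ μ₂) :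
    HasWeakPartial U (0, 1) u.toL2 u.d₂ :=
  (Submodule.inclusion inf_le_right u : weakSubmodule U μ₀ μ₂ (0, 1)).2.choose_spec

theorem WSobolev.norm_sq_eq (u : WSobolev U μ₀ μ₁ μ₂) :
    ‖u‖ ^ 2 = ‖u.toL2‖ ^ 2 + ‖u.d₁‖ ^ 2 + ‖u.d₂‖ ^ 2 := by
  simp only [← real_inner_self_eq_norm_sq]
  rfl

theorem WSobolev.enorm_sq_eq (u : WSobolev U μ₀ μ₁ μ₂) :
    ‖u‖ₑ ^ 2 = eLpNorm u.toL2 2 μ₀ ^ 2 + (eLpNorm u.d₁ 2 μ₁ ^ 2 + eLpNorm u.d₂ 2 μ₂ ^ 2) := by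
  simp only [← Lp.enorm_def, ← ofReal_norm, ← ENNReal.ofReal_pow (norm_nonneg _), u.norm_sq_eq]
  rw [ENNReal.ofReal_add (by positivity) (by positivity),
    ENNReal.ofReal_add (by positivity) (by positivity), add_assoc]

theorem WSobolev.exists_of_hasWeakPartial {f g₁ g₂ : ℝ × ℝ → ℝ} (u : Lp ℝ 2 μ₀)
    (hu : u =ᵐ[μ₀] f) (h₁ : MemLp g₁ 2 μ₁) (h₂ : MemLp g₂ 2 μ₂)
    (hw₁ : HasWeakPartial U (1, 0) f g₁) (hw₂ : HasWeakPartial U (0, 1) f g₂) :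
    ∃ v : WSobolev U μ₀ μ₁ μ₂, v.toL2 = u ∧ v.d₁ =ᵐ[μ₁] g₁ ∧ v.d₂ =ᵐ[μ₂] g₂ := by
  have hu' := (SameNullSets.ca (U := U)).ae_eq hu
  let v : WSobolev U μ₀ μ₁ μ₂ := ⟨u,
    ⟨h₁.toLp g₁, hw₁.congr hu'.symm (SameNullSets.ca.ae_eq h₁.coeFn_toLp.symm)⟩,
    ⟨h₂.toLp g₂, hw₂.congr hu'.symm (SameNullSets.ca.ae_eq h₂.coeFn_toLp.symm)⟩⟩
  have hv : (v.toL2 : ℝ × ℝ → ℝ) =ᵐ[volume.restrict (U : Set (ℝ × ℝ))] f := hu'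
  exact ⟨v, rfl,
    SameNullSets.ac.ae_eq ((v.hasWeakPartial_d₁.congr hv ae_eq_rfl).unique hw₁),
    SameNullSets.ac.ae_eq ((v.hasWeakPartial_d₂.congr hv ae_eq_rfl).unique hw₂)⟩

theorem WSobolev.exists_linearIsometryEquiv {V : Opens (ℝ × ℝ)} {ν₀ ν₁ ν₂ : Measure (ℝ × ℝ)}
    [SameNullSets V ν₀] [SameNullSets V ν₁] [SameNullSets V ν₂] (Φ : Lp ℝ 2 μ₀ →ₗ[ℝ] Lp ℝ 2 ν₀)
    (hisom : ∀ u : WSobolev U μ₀ μ₁ μ₂, ∃ v : WSobolev V ν₀ ν₁ ν₂,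
      v.toL2 = Φ u.toL2 ∧ ‖v‖ = ‖u‖)
    (hsurj : ∀ v : WSobolev V ν₀ ν₁ ν₂, ∃ u : WSobolev U μ₀ μ₁ μ₂, Φ u.toL2 = v.toL2) :
    ∃ Ψ : WSobolev U μ₀ μ₁ μ₂ ≃ₗᵢ[ℝ] WSobolev V ν₀ ν₁ ν₂, ∀ u, (Ψ u).toL2 = Φ u.toL2 := by
  choose T hT hnorm using hisom
  let Ψ : WSobolev U μ₀ μ₁ μ₂ →ₗᵢ[ℝ] WSobolev V ν₀ ν₁ ν₂ :=
    { toFun := T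
      map_add' := fun u v => toL2_injective (by simp only [hT, map_add])
      map_smul' := fun c u => toL2_injective (by simp only [hT, map_smul, RingHom.id_apply])
      norm_map' := hnorm }
  exact ⟨.ofSurjective Ψ fun v => (hsurj v).imp fun u hu => toL2_injective ((hT u).trans hu), hT⟩

end WSobolev

section Pullback

variable {U V : Opens (ℝ × ℝ)} {φ : OrientedDiffeo V U} {J k : ℝ × ℝ → ℝ}
  [SameNullSets V (weightedMeasure V J)] [SameNullSets V (weightedMeasure V k)]
  [SameNullSets V (weightedMeasure V fun q => (k q)⁻¹)]

theorem exists_toL2_eq_compMeasurePreserving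
    (hφ : MeasurePreserving φ (weightedMeasure V J) (volume.restrict (U : Set (ℝ × ℝ))))
    (hk : SatisfiesCauchyRiemann V φ k) (u : H1 U) :
    ∃ v : WSobolev V (weightedMeasure V J) (weightedMeasure V k)
        (weightedMeasure V fun q => (k q)⁻¹),
      v.toL2 = Lp.compMeasurePreserving φ hφ u.toL2 ∧ ‖v‖ = ‖u‖ := by
  have hd₁ := u.hasWeakPartial_d₁
  have hd₂ := u.hasWeakPartial_d₂
  obtain ⟨hg₁, hg₂⟩ :=
    (hk.memLp_pullbackForm_iff hd₁.2.1 hd₂.2.1).2 ⟨Lp.memLp u.d₁, Lp.memLp u.d₂⟩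
  obtain ⟨v, hv, hv₁, hv₂⟩ := WSobolev.exists_of_hasWeakPartial
    (Lp.compMeasurePreserving φ hφ u.toL2) (Lp.coeFn_compMeasurePreserving _ hφ) hg₁ hg₂
    (hd₁.comp φ hd₂ _) (hd₁.comp φ hd₂ _)
  have henorm : ‖v‖ₑ ^ 2 = ‖u‖ₑ ^ 2 := by
    rw [v.enorm_sq_eq, u.enorm_sq_eq, eLpNorm_congr_ae hv₁, eLpNorm_congr_ae hv₂,
      hk.eLpNorm_pullbackForm_sq_add_sq hd₁.2.1 hd₂.2.1, hv,
      eLpNorm_congr_ae (Lp.coeFn_compMeasurePreserving u.toL2 hφ),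
      eLpNorm_comp_measurePreserving (Lp.aestronglyMeasurable u.toL2) hφ]
  have h := (ENNReal.pow_right_strictMono two_ne_zero).injective henorm
  exact ⟨v, hv, by rw [← toReal_enorm v, h, toReal_enorm]⟩

theorem exists_compMeasurePreserving_eq_toL2
    (hφ : MeasurePreserving φ (weightedMeasure V J) (volume.restrict (U : Set (ℝ × ℝ))))
    (hk : SatisfiesCauchyRiemann V φ k)
    (v : WSobolev V (weightedMeasure V J) (weightedMeasure V k)
      (weightedMeasure V fun q => (k q)⁻¹)) :
    ∃ u : H1 U, Lp.compMeasurePreserving φ hφ u.toL2 = v.toL2 := by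
  have hd₁ := v.hasWeakPartial_d₁.comp φ.symm v.hasWeakPartial_d₂ (1, 0)
  have hd₂ := v.hasWeakPartial_d₁.comp φ.symm v.hasWeakPartial_d₂ (0, 1)
  have hV : ∀ w : ℝ × ℝ → ℝ, ∀ᵐ q ∂(weightedMeasure V w), q ∈ V := fun w =>
    (withDensity_absolutelyContinuous _ _).ae_le (ae_restrict_mem V.isOpen.measurableSet)
  have hcomp : (v.toL2 ∘ φ.symm) ∘ φ =ᵐ[weightedMeasure V J] v.toL2 := by
    filter_upwards [hV J] with q hq using congrArg v.toL2 (φ.leftInvOn hq)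
  have hf : MemLp (v.toL2 ∘ φ.symm) 2 (volume.restrict (U : Set (ℝ × ℝ))) := by
    refine ⟨hd₁.1.aestronglyMeasurable, ?_⟩
    rw [← eLpNorm_comp_measurePreserving hd₁.1.aestronglyMeasurable hφ, eLpNorm_congr_ae hcomp]
    exact Lp.eLpNorm_lt_top v.toL2
  have hform (e : ℝ × ℝ) (w : ℝ × ℝ → ℝ) :
      (fun q => e.1 * v.d₁ q + e.2 * v.d₂ q) =ᵐ[weightedMeasure V w]
        φ.pullbackForm (φ.symm.pullbackForm v.d₁ v.d₂ (1, 0))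
          (φ.symm.pullbackForm v.d₁ v.d₂ (0, 1)) e := by
    filter_upwards [hV w] with q hq
      using (φ.symm.pullbackForm_symm_pullbackForm v.d₁ v.d₂ e hq).symm
  obtain ⟨hg₁, hg₂⟩ := (hk.memLp_pullbackForm_iff hd₁.2.1 hd₂.2.1).1
    ⟨(Lp.memLp v.d₁).ae_eq (by simpa using hform (1, 0) k),
      (Lp.memLp v.d₂).ae_eq (by simpa using hform (0, 1) fun q => (k q)⁻¹)⟩
  obtain ⟨u, hu, -, -⟩ :=
    WSobolev.exists_of_hasWeakPartial (hf.toLp _) hf.coeFn_toLp hg₁ hg₂ hd₁ hd₂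
  refine ⟨u, Lp.ext ?_⟩
  rw [hu, Lp.toLp_compMeasurePreserving hf hφ]
  exact (MemLp.coeFn_toLp _).trans hcomp

end Pullback

/-! ### Polar coordinates -/

theorem polarMap_sq (q : ℝ × ℝ) : (polarMap q).1 ^ 2 + (polarMap q).2 ^ 2 = q.1 ^ 2 := by
  simp only [polarMap]
  linear_combination q.1 ^ 2 * Real.cos_sq_add_sin_sq q.2

theorem polarAngle_polarMap {q : ℝ × ℝ} (h0 : 0 < q.1) (h1 : 0 < q.2)
    (h2 : q.2 ≤ 2 * Real.pi) : polarAngle (polarMap q) = q.2 := by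
  have harg := Complex.arg_mul_cos_add_sin_mul_I (r := q.1) (θ := q.2 - Real.pi) h0
    ⟨by linarith, by linarith⟩
  have hneg : -(⟨(polarMap q).1, (polarMap q).2⟩ : ℂ) =
      q.1 * (Complex.cos (q.2 - Real.pi : ℝ) + Complex.sin (q.2 - Real.pi : ℝ) * Complex.I) := by
    rw [← Complex.ofReal_cos, ← Complex.ofReal_sin, Real.cos_sub_pi, Real.sin_sub_pi]
    apply Complex.ext <;> simp [polarMap, -Complex.ofReal_cos, -Complex.ofReal_sin]
  rw [polarAngle, hneg, harg, add_sub_cancel]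

/-- The polar coordinates `(r, θ)` of a point, the angle being `polarAngle`. This is the inverse of
`polarMap`. -/
noncomputable def polarInv (p : ℝ × ℝ) : ℝ × ℝ := (√(p.1 ^ 2 + p.2 ^ 2), polarAngle p)

theorem polarMap_polarInv (p : ℝ × ℝ) : polarMap (polarInv p) = p := by
  have hn : √(p.1 ^ 2 + p.2 ^ 2) = ‖-(⟨p.1, p.2⟩ : ℂ)‖ := by
    rw [norm_neg, Complex.norm_def, Complex.normSq_mk, sq, sq]
  have hc := Complex.norm_mul_cos_arg (-(⟨p.1, p.2⟩ : ℂ))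
  have hs := Complex.norm_mul_sin_arg (-(⟨p.1, p.2⟩ : ℂ))
  simp only [Complex.neg_re, Complex.neg_im] at hc hs
  simp only [polarMap, polarInv, polarAngle, hn, add_comm Real.pi, Real.cos_add_pi,
    Real.sin_add_pi, mul_neg, hc, hs, neg_neg]

theorem polarInv_polarMap {q : ℝ × ℝ} (h0 : 0 < q.1) (h1 : 0 < q.2) (h2 : q.2 ≤ 2 * Real.pi) :
    polarInv (polarMap q) = q := by
  rw [polarInv, polarMap_sq, Real.sqrt_sq h0.le, polarAngle_polarMap h0 h1 h2]

theorem mapsTo_polarInv (Θ : ℝ) : MapsTo polarInv (sector Θ) (rect Θ) :=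
  fun _ ⟨h0, h1, h2, h3⟩ =>
    ⟨⟨Real.sqrt_pos.2 h0, (Real.sqrt_lt' one_pos).2 (by simpa using h1)⟩, h2, h3⟩

theorem mapsTo_polarMap {Θ : ℝ} (hΘ : Θ ≤ 2 * Real.pi) : MapsTo polarMap (rect Θ) (sector Θ) := by
  rintro q ⟨⟨h0, h1⟩, h2, h3⟩
  have hangle := polarAngle_polarMap h0 h2 (h3.le.trans hΘ)
  exact ⟨by rw [polarMap_sq]; positivity, by rw [polarMap_sq]; nlinarith,
    hangle.symm ▸ h2, hangle.symm ▸ h3⟩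

theorem contDiff_polarMap {n : WithTop ℕ∞} : ContDiff ℝ n polarMap :=
  (contDiff_fst.mul (Real.contDiff_cos.comp contDiff_snd)).prodMk
    (contDiff_fst.mul (Real.contDiff_sin.comp contDiff_snd))

theorem measurable_polarMap : Measurable polarMap :=
  (contDiff_polarMap (n := 0)).continuous.measurable

theorem neg_mem_slitPlane_of_polarAngle_lt {p : ℝ × ℝ} (hp : 0 < p.1 ^ 2 + p.2 ^ 2)
    (hangle : polarAngle p < 2 * Real.pi) : -(⟨p.1, p.2⟩ : ℂ) ∈ Complex.slitPlane := by
  refine Complex.mem_slitPlane_iff_arg.2 ⟨fun harg => ?_, fun hzero => ?_⟩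
  · rw [polarAngle, harg] at hangle
    linarith
  · obtain ⟨h₁, h₂⟩ : p.1 = 0 ∧ p.2 = 0 := by simpa [Complex.ext_iff] using hzero
    simp [h₁, h₂] at hp

theorem contDiffAt_polarAngle {p : ℝ × ℝ} (hp : 0 < p.1 ^ 2 + p.2 ^ 2)
    (hangle : polarAngle p < 2 * Real.pi) {n : WithTop ℕ∞} : ContDiffAt ℝ n polarAngle p := by
  have hneg : ContDiffAt ℝ n (fun q : ℝ × ℝ => -(⟨q.1, q.2⟩ : ℂ)) p :=
    Complex.equivRealProdCLM.symm.contDiff.neg.contDiffAt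
  have hlog : ContDiffAt ℝ n Complex.log (-(⟨p.1, p.2⟩ : ℂ)) :=
    (Complex.contDiffAt_log (neg_mem_slitPlane_of_polarAngle_lt hp hangle)).restrict_scalars ℝ
  have him : ContDiffAt ℝ n (fun q : ℝ × ℝ => (Complex.log (-(⟨q.1, q.2⟩ : ℂ))).im) p :=
    Complex.imCLM.contDiff.contDiffAt.comp p (ContDiffAt.comp (g := Complex.log) p hlog hneg)
  simp only [Complex.log_im] at him
  exact contDiffAt_const.add him

theorem contDiffOn_polarInv {Θ : ℝ} (hΘ : Θ ≤ 2 * Real.pi) {n : WithTop ℕ∞} :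
    ContDiffOn ℝ n polarInv (sector Θ) :=
  ((contDiff_fst.pow 2).add (contDiff_snd.pow 2)).contDiffOn.sqrt (fun _ hp => hp.1.ne')
    |>.prodMk fun _ hp => (contDiffAt_polarAngle hp.1 (hp.2.2.2.trans_le hΘ)).contDiffWithinAt

theorem fderiv_polarMap (q : ℝ × ℝ) : fderiv ℝ polarMap q = fderivPolarCoordSymm q :=
  (hasFDerivAt_polarCoord_symm q).fderiv

theorem det_fderiv_polarMap (q : ℝ × ℝ) : (fderiv ℝ polarMap q).det = q.1 := by
  rw [fderiv_polarMap, det_fderivPolarCoordSymm]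

theorem satisfiesCauchyRiemann_polarMap (V : Opens (ℝ × ℝ)) :
    SatisfiesCauchyRiemann V polarMap Prod.fst := fun q _ => by
  rw [fderiv_polarMap, fderivPolarCoordSymm, Matrix.toLin_finTwoProd_toContinuousLinearMap]
  ext <;> simp

/-- Polar coordinates as a diffeomorphism from the rectangle onto the sector. -/
noncomputable def polarDiffeo {Θ : ℝ} (hΘ : Θ ≤ 2 * Real.pi) :
    OrientedDiffeo (rect Θ) (sector Θ) where
  toFun := polarMap
  invFun := polarInv
  mapsTo := mapsTo_polarMap hΘ
  mapsTo_inv := mapsTo_polarInv Θ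
  leftInvOn _ hq := polarInv_polarMap hq.1.1 hq.2.1 (hq.2.2.le.trans hΘ)
  rightInvOn p _ := polarMap_polarInv p
  contDiffOn := contDiff_polarMap.contDiffOn
  contDiffOn_inv := contDiffOn_polarInv hΘ
  det_pos q hq := (det_fderiv_polarMap q).symm ▸ hq.1.1

end PolarSobolev

open PolarSobolev in
theorem mainTheorem3_general {U V : Opens (ℝ × ℝ)} (φ : OrientedDiffeo V U) (hφ : Measurable φ)
    {J k : ℝ × ℝ → ℝ} (hJ : ∀ q ∈ V, (fderiv ℝ φ q).det = J q) (hk : SatisfiesCauchyRiemann V φ k)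
    [SameNullSets V (weightedMeasure V J)] [SameNullSets V (weightedMeasure V k)]
    [SameNullSets V (weightedMeasure V fun q => (k q)⁻¹)] :
    ∃ Φ : Lp ℝ 2 (volume.restrict (U : Set (ℝ × ℝ))) →ₗ[ℝ] Lp ℝ 2 (weightedMeasure V J),
      (∀ (u : Lp ℝ 2 (volume.restrict (U : Set (ℝ × ℝ)))) (f : ℝ × ℝ → ℝ),
        u =ᵐ[volume.restrict (U : Set (ℝ × ℝ))] f →
          Φ u =ᵐ[volume.restrict (V : Set (ℝ × ℝ))] f ∘ φ) ∧
      ∃ Ψ : H1 U ≃ₗᵢ[ℝ] WSobolev V (weightedMeasure V J) (weightedMeasure V k)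
          (weightedMeasure V fun q => (k q)⁻¹),
        ∀ u : H1 U, (Ψ u).toL2 = Φ u.toL2 := by
  have hmp := φ.measurePreserving hφ hJ
  refine ⟨(Lp.compMeasurePreservingₗᵢ ℝ φ hmp).toLinearMap, fun u f hf => ?_,
    WSobolev.exists_linearIsometryEquiv _ (exists_toL2_eq_compMeasurePreserving hmp hk)
      (exists_compMeasurePreserving_eq_toL2 hmp hk)⟩
  exact (SameNullSets.ca (U := V)).ae_eq ((Lp.coeFn_compMeasurePreserving u hmp).trans
    (hmp.quasiMeasurePreserving.ae_eq hf))

open PolarSobolev in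
theorem mainTheorem3 (Θ : ℝ) (hΘ : Θ ∈ Ioo 0 (2 * Real.pi)) :
    ∃ Φ : Lp ℝ 2 (volume.restrict (sector Θ : Set (ℝ × ℝ))) →ₗ[ℝ] Lp ℝ 2 (measR Θ),
      (∀ (u : Lp ℝ 2 (volume.restrict (sector Θ : Set (ℝ × ℝ)))) (f : ℝ × ℝ → ℝ),
        u =ᵐ[volume.restrict (sector Θ : Set (ℝ × ℝ))] f →
          Φ u =ᵐ[volume.restrict (rect Θ : Set (ℝ × ℝ))] f ∘ polarMap) ∧
      ∃ Ψ : H1 (sector Θ) ≃ₗᵢ[ℝ] HTilde Θ, ∀ u : H1 (sector Θ), (Ψ u).toL2 = Φ u.toL2 := by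
  have : SameNullSets (rect Θ) (weightedMeasure (rect Θ) Prod.fst) := instSameNullSetsMeasR Θ
  have : SameNullSets (rect Θ) (weightedMeasure (rect Θ) fun q => q.1⁻¹) :=
    instSameNullSetsMeasRInv Θ
  exact mainTheorem3_general (polarDiffeo hΘ.2.le) measurable_polarMap
    (fun q _ => det_fderiv_polarMap q) (satisfiesCauchyRiemann_polarMap (rect Θ))
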